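/- Let $\mu,\nu$ be probability measures on $\mathbb{R}$ with finite first moments such that $\mu$ has no atoms, and let $\mathcal{M}(\mu,\nu)$ be the set of probability measures $\mathbb{P}$ on $\mathbb{R}\times\mathbb{R}$ with marginals $\mu$ and $\nu$ such that $\mathbb{E}^{\mathbb{P}}[Y\mid X]=X$ a.s., where $(X,Y)$ are the coordinate maps. Call $\mathbb{P}\in\mathcal{M}(\mu,\nu)$ *left-monotone* if there is a Borel set $\Gamma\subset\mathbb{R}\times\mathbb{R}$ with $\mathbb{P}(\Gamma)=1$ such that $y'\notin(y_0,y_1)$ for all $(x,y_0),(x,y_1),(x',y')\in\Gamma$ with $x<x'$. Let $\mathbb{P}_1,\mathbb{P}_2\in\mathcal{M}(\mu,\nu)$ be left-monotone. For $i=1,2$ let $S_i\subset\mathbb{R}$ be a set of full $\mu$-measure (for example $S_i=\mathbb{R}$) and let $T^i_d,T^i_u$ be real-valued functions on $S_i$ such that - $T^i_d(x)\le x\le T^i_u(x)$ for all $x\in S_i$, and $T^i_d(x)=x$ if and only if $T^i_u(x)=x$; - $\mathbb{P}_i(dx,dy)=\mu(dx)\,\big[q_i(x)\,\delta_{T^i_u(x)}+(1-q_i(x))\,\delta_{T^i_d(x)}\big](dy)$,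 where $q_i(x)=\frac{x-T^i_d(x)}{T^i_u(x)-T^i_d(x)}$ if $T^i_d(x)<T^i_u(x)$ and $q_i(x)=0$ otherwise; - $T^i_u$ is nondecreasing on $S_i$; - if $x<y$ in $S_i$, then $T^i_d(y)\notin(T^i_d(x),T^i_u(x))$. Define the barriers $$R^{\mathbb{P}_i}:=\bigcup_{x\in S_i}\Big([T^i_u(x)-x,\infty)\times\{T^i_u(x)\}\Big)\;\cup\;\bigcup_{x\in S_i}\Big([T^i_d(x)-x,\infty)\times\{T^i_d(x)\}\Big),\qquad i=1,2.$$ Let $(B_t)_{t\ge0}$ be a one-dimensional Brownian motion with $B_0\sim\mu$, and let $\tau_{R}:=\inf\{t\ge0:(B_t-B_0,B_t)\in R\}$ (with $\inf\emptyset=\infty$). Then $$\tau_{R^{\mathbb{P}_1}}=\tau_{R^{\mathbb{P}_2}}\quad\text{almost surely.}$$ -/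

import Mathlib

open MeasureTheory ProbabilityTheory Set
open scoped NNReal ENNReal

noncomputable section

namespace MartingaleTransport

/-- The set of martingale transport plans between `μ` and `ν`: probability measures on `ℝ × ℝ`
with marginals `μ` and `ν` under which the coordinates `X = Prod.fst`, `Y = Prod.snd` satisfy
`E[Y | X] = X` almost surely. -/
structure IsMartingalePlan (μ ν : Measure ℝ) (P : Measure (ℝ × ℝ)) : Prop where
  isProbabilityMeasure : IsProbabilityMeasure P
  map_fst : P.map Prod.fst = μ
  map_snd : P.map Prod.snd = ν
  integrable_snd : Integrable Prod.snd P
  condExp_eq :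
    P[(Prod.snd : ℝ × ℝ → ℝ) | MeasurableSpace.comap Prod.fst inferInstance] =ᵐ[P] Prod.fst

/-- A measure `P` on `ℝ × ℝ` is left-monotone if it is carried by a Borel set `Γ` such that
`y' ∉ (y₀, y₁)` whenever `(x, y₀), (x, y₁), (x', y') ∈ Γ` and `x < x'`. -/
def IsLeftMonotone (P : Measure (ℝ × ℝ)) : Prop :=
  ∃ Γ : Set (ℝ × ℝ), MeasurableSet Γ ∧ P Γ = 1 ∧
    ∀ x x' y₀ y₁ y' : ℝ, (x, y₀) ∈ Γ → (x, y₁) ∈ Γ → (x', y') ∈ Γ → x < x' →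
      y' ∉ Ioo y₀ y₁

open Classical in
/-- The weight `q(x) = (x - T_d(x)) / (T_u(x) - T_d(x)) 1_{T_d(x) < T_u(x)}`. -/
def upWeight (Td Tu : ℝ → ℝ) (x : ℝ) : ℝ :=
  if Td x < Tu x then (x - Td x) / (Tu x - Td x) else 0

/-- The two-point measure `q(x) δ_{T_u(x)} + (1 - q(x)) δ_{T_d(x)}`. -/
def twoPoint (Td Tu : ℝ → ℝ) (x : ℝ) : Measure ℝ :=
  ENNReal.ofReal (upWeight Td Tu x) • Measure.dirac (Tu x) +
    ENNReal.ofReal (1 - upWeight Td Tu x) • Measure.dirac (Td x)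

/-- `(T_d, T_u)`, regarded as maps on the set `S` of full `μ`-measure, represent the plan `P`:
the order properties hold at every point of `S`, and
`P(dx, dy) = μ(dx) [q(x) δ_{T_u(x)} + (1 - q(x)) δ_{T_d(x)}](dy)`.
The values of `T_d` and `T_u` outside `S` play no role; `S = univ` is allowed. -/
structure IsMonotoneMapPair (μ : Measure ℝ) (P : Measure (ℝ × ℝ)) (S : Set ℝ)
    (Td Tu : ℝ → ℝ) : Prop where
  ae_mem : ∀ᵐ x ∂μ, x ∈ S
  down_le : ∀ x ∈ S, Td x ≤ x
  le_up : ∀ x ∈ S, x ≤ Tu x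
  down_eq_iff : ∀ x ∈ S, Td x = x ↔ Tu x = x
  disintegration : ∃ κ : Kernel ℝ ℝ, IsMarkovKernel κ ∧ P = μ ⊗ₘ κ ∧
    ∀ᵐ x ∂μ, κ x = twoPoint Td Tu x
  up_monotoneOn : MonotoneOn Tu S
  down_notMem : ∀ x ∈ S, ∀ y ∈ S, x < y → Td y ∉ Ioo (Td x) (Tu x)

/-- The barrier `R = R_u ∪ R_d`, where `R_i` is the union over `x ∈ S` of the half-lines
`[T_i(x) - x, ∞) × {T_i(x)}`. -/
def barrier (S : Set ℝ) (Td Tu : ℝ → ℝ) : Set (ℝ × ℝ) :=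
  (⋃ x ∈ S, Ici (Tu x - x) ×ˢ {Tu x}) ∪ (⋃ x ∈ S, Ici (Td x - x) ×ˢ {Td x})

/-- `B` is a one-dimensional Brownian motion with initial law `μ` under `Pr`. -/
structure IsBrownianFrom {Ω : Type*} [MeasurableSpace Ω] (μ : Measure ℝ)
    (B : ℝ≥0 → Ω → ℝ) (Pr : Measure Ω) : Prop where
  hasLaw_zero : HasLaw (B 0) μ Pr
  isBrownian_sub : IsBrownianReal (fun t ω => B t ω - B 0 ω) Pr
  indep : IndepFun (B 0) (fun ω (t : ℝ≥0) => B t ω - B 0 ω) Pr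

/-- The hitting time `τ_R = inf {t ≥ 0 : (B_t - B_0, B_t) ∈ R}`, with value `⊤` if the set
`R` is never hit. -/
def barrierTime {Ω : Type*} (B : ℝ≥0 → Ω → ℝ) (R : Set (ℝ × ℝ)) : Ω → WithTop ℝ≥0 :=
  hittingAfter (fun t ω => (B t ω - B 0 ω, B t ω)) R 0

end MartingaleTransport

end

open MartingaleTransport

/-! The maps are determined by `μ` and `ν` up to null sets, and the hitting time sees them only
through the starting point. Uniqueness (`setLIntegral_abs_sub_le`): for each `x` and `k`, the part
of a plan starting in `(-∞, x]` has the least possible potential at `k`. Let `D` be the set of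
targets of later points. There is a convex `φ ≥ |· - k|`, equal to it on `D`, whose kinks lie in
`closure D`. No earlier interval `(Td z, Tu z)` meets `closure D`, so `φ` is affine on each one and
its integral is as small as Jensen allows; the gap `φ - |· - k|` vanishes on later targets, so its
integral is as large as `ν` allows. Exchanging the plans gives equality for all `x`, hence equal
pointwise potentials a.e., and these determine the two points. Hitting: started at `x ∈ S`, a
continuous path first meets the barrier when it leaves `(Td x, Tu x)`. -/

namespace MartingaleTransport

/-! ### Potentials of centred two-point measures. -/

section TwoPoint

variable {Td Tu : ℝ → ℝ} {x : ℝ}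

/-- The mean of `f` under the two-point measure at `x`. -/
noncomputable def twoPointMean (Td Tu : ℝ → ℝ) (f : ℝ → ℝ) (x : ℝ) : ℝ :=
  upWeight Td Tu x * f (Tu x) + (1 - upWeight Td Tu x) * f (Td x)

lemma upWeight_nonneg (hd : Td x ≤ x) : 0 ≤ upWeight Td Tu x := by
  unfold upWeight
  split_ifs with h
  · exact div_nonneg (by linarith) (by linarith)
  · exact le_rfl

lemma upWeight_le_one (hu : x ≤ Tu x) : upWeight Td Tu x ≤ 1 := by
  unfold upWeight
  split_ifs with h
  · rw [div_le_one (by linarith)]; linarith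
  · exact zero_le_one

lemma twoPointMean_id (hd : Td x ≤ x) (hu : x ≤ Tu x) :
    upWeight Td Tu x * Tu x + (1 - upWeight Td Tu x) * Td x = x := by
  unfold upWeight
  split_ifs with h
  · have : Tu x - Td x ≠ 0 := by linarith
    field_simp
    ring
  · linarith

lemma lintegral_twoPoint (hd : Td x ≤ x) (hu : x ≤ Tu x) {f : ℝ → ℝ} (hf : ∀ y, 0 ≤ f y) :
    ∫⁻ y, ENNReal.ofReal (f y) ∂twoPoint Td Tu x = ENNReal.ofReal (twoPointMean Td Tu f x) := by
  have h0 := upWeight_nonneg (Tu := Tu) hd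
  have h1 := upWeight_le_one (Td := Td) hu
  have h1' : 0 ≤ 1 - upWeight Td Tu x := by linarith
  rw [twoPoint, lintegral_add_measure, lintegral_smul_measure, lintegral_smul_measure,
    lintegral_dirac, lintegral_dirac, twoPointMean,
    ENNReal.ofReal_add (mul_nonneg h0 (hf _)) (mul_nonneg h1' (hf _)),
    ENNReal.ofReal_mul h0, ENNReal.ofReal_mul h1', smul_eq_mul, smul_eq_mul]

/-- Jensen's inequality, as the two-point measure has mean `x`. -/
lemma abs_sub_le_twoPointMean (hd : Td x ≤ x) (hu : x ≤ Tu x) (a : ℝ) :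
    |x - a| ≤ twoPointMean Td Tu (fun y => |y - a|) x := by
  have h0 := upWeight_nonneg (Tu := Tu) hd
  have h1 : 0 ≤ 1 - upWeight Td Tu x := by linarith [upWeight_le_one (Td := Td) hu]
  have hm := twoPointMean_id hd hu
  unfold twoPointMean
  rcases abs_cases (x - a) with ⟨h, _⟩ | ⟨h, _⟩ <;> rw [h]
  · nlinarith [mul_le_mul_of_nonneg_left (le_abs_self (Tu x - a)) h0,
      mul_le_mul_of_nonneg_left (le_abs_self (Td x - a)) h1]
  · nlinarith [mul_le_mul_of_nonneg_left (neg_le_abs (Tu x - a)) h0,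
      mul_le_mul_of_nonneg_left (neg_le_abs (Td x - a)) h1]

/-- Equality in Jensen: `|· - a|` is affine on `[Td x, Tu x]`. -/
lemma twoPointMean_abs_sub_of_notMem (hd : Td x ≤ x) (hu : x ≤ Tu x) {a : ℝ}
    (ha : a ∉ Ioo (Td x) (Tu x)) :
    twoPointMean Td Tu (fun y => |y - a|) x = |x - a| := by
  have hm := twoPointMean_id hd hu
  unfold twoPointMean
  dsimp only
  rcases le_or_gt a (Td x) with h | h
  · rw [abs_of_nonneg (by linarith : 0 ≤ Tu x - a), abs_of_nonneg (by linarith : 0 ≤ Td x - a),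
      abs_of_nonneg (by linarith : 0 ≤ x - a)]
    linarith
  · have h' : Tu x ≤ a := by
      by_contra! h'
      exact ha ⟨h, h'⟩
    rw [abs_of_nonpos (by linarith : Tu x - a ≤ 0), abs_of_nonpos (by linarith : Td x - a ≤ 0),
      abs_of_nonpos (by linarith : x - a ≤ 0)]
    linarith

/-- Jensen is strict when the kink is interior: `hdu` makes both weights positive. -/
lemma abs_sub_lt_twoPointMean_of_mem (hd : Td x ≤ x) (hu : x ≤ Tu x)
    (hdu : Td x = x ↔ Tu x = x) {a : ℝ} (ha : a ∈ Ioo (Td x) (Tu x)) :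
    |x - a| < twoPointMean Td Tu (fun y => |y - a|) x := by
  have hlt : Td x < Tu x := ha.1.trans ha.2
  have hd' : Td x < x := lt_of_le_of_ne hd fun h => by
    have := hdu.1 h
    linarith
  have hu' : x < Tu x := lt_of_le_of_ne hu fun h => hd'.ne (hdu.2 h.symm)
  have hm := twoPointMean_id hd hu
  have h0 : 0 < upWeight Td Tu x := by
    rw [upWeight, if_pos hlt]
    exact div_pos (by linarith) (by linarith)
  have h1 : 0 < 1 - upWeight Td Tu x := by
    rw [upWeight, if_pos hlt, sub_pos, div_lt_one (by linarith)]
    linarith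
  unfold twoPointMean
  dsimp only
  rw [abs_of_pos (by linarith [ha.2] : 0 < Tu x - a),
    abs_of_neg (by linarith [ha.1] : Td x - a < 0)]
  rcases abs_cases (x - a) with ⟨h, _⟩ | ⟨h, _⟩ <;> rw [h]
  · nlinarith [mul_pos h1 (sub_pos.2 ha.1)]
  · nlinarith [mul_pos h0 (sub_pos.2 ha.2)]

lemma twoPointMean_affine_comb (f g : ℝ → ℝ) (l c : ℝ) :
    twoPointMean Td Tu (fun y => l * f y + (1 - l) * g y + c) x =
      l * twoPointMean Td Tu f x + (1 - l) * twoPointMean Td Tu g x + c := by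
  unfold twoPointMean
  ring

/-- The potential of the two-point measure at `x` determines the two points. -/
lemma eq_of_twoPointMean_abs_sub_eq {Td' Tu' : ℝ → ℝ} (hd : Td x ≤ x) (hu : x ≤ Tu x)
    (hdu : Td x = x ↔ Tu x = x) (hd' : Td' x ≤ x) (hu' : x ≤ Tu' x)
    (hdu' : Td' x = x ↔ Tu' x = x)
    (h : ∀ k : ℚ, twoPointMean Td Tu (fun y => |y - k|) x =
      twoPointMean Td' Tu' (fun y => |y - k|) x) :
    Td x = Td' x ∧ Tu x = Tu' x := by
  -- Membership in the interval is exactly strictness in Jensen, which the potential detects.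
  have key : ∀ k : ℚ, (k : ℝ) ∈ Ioo (Td x) (Tu x) ↔ (k : ℝ) ∈ Ioo (Td' x) (Tu' x) := by
    intro k
    constructor
    · intro hk
      by_contra hk'
      have h1 := abs_sub_lt_twoPointMean_of_mem hd hu hdu hk
      rw [h, twoPointMean_abs_sub_of_notMem hd' hu' hk'] at h1
      exact lt_irrefl _ h1
    · intro hk
      by_contra hk'
      have h1 := abs_sub_lt_twoPointMean_of_mem hd' hu' hdu' hk
      rw [← h, twoPointMean_abs_sub_of_notMem hd hu hk'] at h1
      exact lt_irrefl _ h1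
  have pos : ∀ {a b : ℝ}, a ≤ x → x ≤ b → (a = x ↔ b = x) → a < x ∨ x < b → a < x ∧ x < b := by
    intro a b ha hb hab h
    rcases h with h | h
    · exact ⟨h, lt_of_le_of_ne hb fun e => h.ne (hab.2 e.symm)⟩
    · exact ⟨lt_of_le_of_ne ha fun e => h.ne' (hab.1 e), h⟩
  constructor
  · rcases lt_trichotomy (Td x) (Td' x) with hlt | heq | hlt
    · obtain ⟨k, hk1, hk2⟩ := exists_rat_btwn hlt
      have := pos hd hu hdu (Or.inl (hlt.trans_le hd'))
      have := ((key k).1 ⟨hk1, by linarith⟩).1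
      linarith
    · exact heq
    · obtain ⟨k, hk1, hk2⟩ := exists_rat_btwn hlt
      have := pos hd' hu' hdu' (Or.inl (hlt.trans_le hd))
      have := ((key k).2 ⟨hk1, by linarith⟩).1
      linarith
  · rcases lt_trichotomy (Tu x) (Tu' x) with hlt | heq | hlt
    · obtain ⟨k, hk1, hk2⟩ := exists_rat_btwn hlt
      have := pos hd' hu' hdu' (Or.inr (hu.trans_lt hlt))
      have := ((key k).2 ⟨by linarith, hk2⟩).2
      linarith
    · exact heq
    · obtain ⟨k, hk1, hk2⟩ := exists_rat_btwn hlt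
      have := pos hd hu hdu (Or.inr (hu'.trans_lt hlt))
      have := ((key k).1 ⟨by linarith, hk2⟩).2
      linarith

end TwoPoint

/-! ### Moving the kink of `|· - k|` into the closure of a set. -/

lemma abs_sub_affine_comb_le {a b k l c : ℝ} (hl0 : 0 ≤ l) (hl1 : l ≤ 1)
    (hc : |l * a + (1 - l) * b - k| ≤ c) (y : ℝ) :
    |y - k| ≤ l * |y - a| + (1 - l) * |y - b| + c := by
  have h1 : 0 ≤ 1 - l := by linarith
  have e : y - k = l * (y - a) + (1 - l) * (y - b) + (l * a + (1 - l) * b - k) := by ring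
  rw [e]
  refine (abs_add_three _ _ _).trans ?_
  rw [abs_mul, abs_mul, abs_of_nonneg hl0, abs_of_nonneg h1]
  linarith

/-- For every level `k` and every set `D`, `|y - k|` is dominated by a mixture of
`|y - a|` and `|y - b|` up to a constant, with equality on `D`, where `a` and `b` are limits of
points of `D`. -/
lemma exists_affine_comb_abs_sub {D : Set ℝ} (hD : D.Nonempty) (k : ℝ) :
    ∃ l a b c : ℝ, 0 ≤ l ∧ l ≤ 1 ∧ a ∈ closure D ∧ b ∈ closure D ∧
      (∀ y, |y - k| ≤ l * |y - a| + (1 - l) * |y - b| + c) ∧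
      ∀ y ∈ D, |y - k| = l * |y - a| + (1 - l) * |y - b| + c := by
  have lower : (D ∩ Iic k).Nonempty → ∃ a ∈ closure D, a ≤ k ∧ ∀ y ∈ D, y ≤ a ∨ k < y := by
    intro h
    have hb : BddAbove (D ∩ Iic k) := ⟨k, fun y hy => hy.2⟩
    refine ⟨sSup (D ∩ Iic k), closure_mono inter_subset_left (csSup_mem_closure h hb),
      csSup_le h fun y hy => hy.2, fun y hy => ?_⟩
    rcases le_or_gt y k with hyk | hyk
    · exact Or.inl (le_csSup hb ⟨hy, hyk⟩)
    · exact Or.inr hyk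
  have upper : (D ∩ Ioi k).Nonempty → ∃ b ∈ closure D, k ≤ b ∧ ∀ y ∈ D, b ≤ y ∨ y ≤ k := by
    intro h
    have hb : BddBelow (D ∩ Ioi k) := ⟨k, fun y hy => le_of_lt hy.2⟩
    refine ⟨sInf (D ∩ Ioi k), closure_mono inter_subset_left (csInf_mem_closure h hb),
      le_csInf h fun y hy => le_of_lt hy.2, fun y hy => ?_⟩
    rcases le_or_gt y k with hyk | hyk
    · exact Or.inr hyk
    · exact Or.inl (csInf_le hb ⟨hy, hyk⟩)
  rcases (D ∩ Iic k).eq_empty_or_nonempty with h1 | h1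
  · have hgt : ∀ y ∈ D, k < y := fun y hy => by
      by_contra! h
      exact (h1 ▸ (⟨hy, h⟩ : y ∈ D ∩ Iic k) : y ∈ (∅ : Set ℝ))
    obtain ⟨b, hbD, hkb, hb⟩ := upper (hD.imp fun y hy => ⟨hy, hgt y hy⟩)
    refine ⟨0, b, b, b - k, le_rfl, zero_le_one, hbD, hbD, fun y => ?_,
      fun y hy => ?_⟩
    · exact abs_sub_affine_comb_le le_rfl zero_le_one
        (by rw [abs_of_nonneg] <;> linarith) y
    · have hyk := hgt y hy
      have hyb : b ≤ y := (hb y hy).resolve_right (by linarith)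
      rw [abs_of_pos (by linarith), abs_of_nonneg (by linarith : 0 ≤ y - b)]
      ring
  obtain ⟨a, haD, hak, ha⟩ := lower h1
  rcases (D ∩ Ioi k).eq_empty_or_nonempty with h2 | h2
  · have hle : ∀ y ∈ D, y ≤ k := fun y hy => by
      by_contra! h
      exact (h2 ▸ (⟨hy, h⟩ : y ∈ D ∩ Ioi k) : y ∈ (∅ : Set ℝ))
    refine ⟨0, a, a, k - a, le_rfl, zero_le_one, haD, haD, fun y => ?_,
      fun y hy => ?_⟩
    · exact abs_sub_affine_comb_le le_rfl zero_le_one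
        (by rw [abs_of_nonpos] <;> linarith) y
    · have hyk := hle y hy
      have hya : y ≤ a := (ha y hy).resolve_right (by linarith)
      rw [abs_of_nonpos (by linarith), abs_of_nonpos (by linarith : y - a ≤ 0)]
      ring
  obtain ⟨b, hbD, hkb, hb⟩ := upper h2
  -- `a` and `b` bound the gap of `D` around `k`; writing `k` as their barycentre makes the mixture
  -- agree with `|· - k|` outside the gap.
  obtain ⟨l, l', hl0, hl0', hll, hk⟩ :=
    (segment_eq_Icc (hak.trans hkb) ▸ ⟨hak, hkb⟩ : k ∈ segment ℝ a b)
  obtain rfl : l' = 1 - l := by linarith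
  simp only [smul_eq_mul] at hk
  refine ⟨l, a, b, 0, hl0, by linarith, haD, hbD, fun y => ?_, fun y hy => ?_⟩
  · exact abs_sub_affine_comb_le hl0 (by linarith) (by rw [hk, sub_self, abs_zero]) y
  · rcases ha y hy with hya | hyk
    · rw [abs_of_nonpos (by linarith), abs_of_nonpos (by linarith : y - a ≤ 0),
        abs_of_nonpos (by linarith : y - b ≤ 0)]
      linarith
    · have hyb : b ≤ y := (hb y hy).resolve_right (by linarith)
      rw [abs_of_nonneg (by linarith), abs_of_nonneg (by linarith : 0 ≤ y - a),
        abs_of_nonneg (by linarith : 0 ≤ y - b)]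
      linarith

/-! ### Uniqueness of the maps. -/

section Uniqueness

variable {μ ν : Measure ℝ} {P P₁ P₂ : Measure (ℝ × ℝ)} {S S₁ S₂ : Set ℝ}
  {Td Tu Td₁ Tu₁ Td₂ Tu₂ : ℝ → ℝ}

/-- The points reached from starting points in `S` beyond `x`. -/
def laterTargets (S : Set ℝ) (Td Tu : ℝ → ℝ) (x : ℝ) : Set ℝ :=
  {y | ∃ z ∈ S, x < z ∧ (y = Tu z ∨ y = Td z)}

/-- An open interval meeting the closure would contain a later target, which the order properties
forbid. -/
lemma IsMonotoneMapPair.notMem_Ioo_of_mem_closure (hT : IsMonotoneMapPair μ P S Td Tu)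
    {x z a : ℝ} (hz : z ∈ S) (hzx : z ≤ x) (ha : a ∈ closure (laterTargets S Td Tu x)) :
    a ∉ Ioo (Td z) (Tu z) := by
  intro haI
  obtain ⟨y, hyI, w, hw, hxw, rfl | rfl⟩ := mem_closure_iff.1 ha _ isOpen_Ioo haI
  · exact absurd hyI.2 (not_lt.2 (hT.up_monotoneOn hz hw (hzx.trans hxw.le)))
  · exact hT.down_notMem z hz w hw (hzx.trans_lt hxw) hyI

lemma IsMonotoneMapPair.ae_lintegral_eq (hT : IsMonotoneMapPair μ P S Td Tu)
    {κ : Kernel ℝ ℝ} (hκ : ∀ᵐ x ∂μ, κ x = twoPoint Td Tu x) {f : ℝ → ℝ} (hf : ∀ y, 0 ≤ f y) :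
    ∀ᵐ x ∂μ, x ∈ S ∧
      ∫⁻ y, ENNReal.ofReal (f y) ∂κ x = ENNReal.ofReal (twoPointMean Td Tu f x) := by
  filter_upwards [hκ, hT.ae_mem] with x hx hxS
  exact ⟨hxS, by rw [hx, lintegral_twoPoint (hT.down_le x hxS) (hT.le_up x hxS) hf]⟩

lemma IsMartingalePlan.lintegral_lintegral [SFinite μ] (hP : IsMartingalePlan μ ν P)
    {κ : Kernel ℝ ℝ} [IsMarkovKernel κ] (hκ : P = μ ⊗ₘ κ) {f : ℝ → ℝ≥0∞} (hf : Measurable f) :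
    ∫⁻ x, ∫⁻ y, f y ∂κ x ∂μ = ∫⁻ y, f y ∂ν := by
  rw [← hP.map_snd, lintegral_map hf measurable_snd, hκ,
    Measure.lintegral_compProd (f := fun p : ℝ × ℝ => f p.2) (hf.comp measurable_snd)]

/-- Minimality of the potential of the second marginal of a left-monotone plan restricted to
starting points in `(-∞, x]`. -/
lemma setLIntegral_abs_sub_le [IsProbabilityMeasure μ] [IsProbabilityMeasure ν]
    (hν : Integrable (fun y : ℝ => y) ν)
    (hP₁ : IsMartingalePlan μ ν P₁) (hP₂ : IsMartingalePlan μ ν P₂)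
    (hT₁ : IsMonotoneMapPair μ P₁ S₁ Td₁ Tu₁) (hT₂ : IsMonotoneMapPair μ P₂ S₂ Td₂ Tu₂)
    {κ₁ κ₂ : Kernel ℝ ℝ} [IsMarkovKernel κ₁] [IsMarkovKernel κ₂]
    (hκ₁ : P₁ = μ ⊗ₘ κ₁) (hκ₂ : P₂ = μ ⊗ₘ κ₂)
    (hκT₁ : ∀ᵐ x ∂μ, κ₁ x = twoPoint Td₁ Tu₁ x) (hκT₂ : ∀ᵐ x ∂μ, κ₂ x = twoPoint Td₂ Tu₂ x)
    (x k : ℝ) :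
    ∫⁻ z in Iic x, ∫⁻ y, ENNReal.ofReal |y - k| ∂κ₁ z ∂μ ≤
      ∫⁻ z in Iic x, ∫⁻ y, ENNReal.ofReal |y - k| ∂κ₂ z ∂μ := by
  have hm : Measurable fun y : ℝ => ENNReal.ofReal |y - k| := by fun_prop
  rcases (laterTargets S₁ Td₁ Tu₁ x).eq_empty_or_nonempty with hD | hD
  · have hx : ∀ᵐ z ∂μ, z ∈ Iic x := by
      filter_upwards [hT₁.ae_mem] with z hz
      by_contra! h
      exact (hD ▸ (⟨z, hz, not_le.1 h, Or.inl rfl⟩ : Tu₁ z ∈ laterTargets S₁ Td₁ Tu₁ x) :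
        Tu₁ z ∈ (∅ : Set ℝ))
    rw [Measure.restrict_eq_self_of_ae_mem hx, hP₁.lintegral_lintegral hκ₁ hm,
      hP₂.lintegral_lintegral hκ₂ hm]
  obtain ⟨l, a, b, c, hl0, hl1, ha, hb, hle, heq⟩ := exists_affine_comb_abs_sub hD k
  have hl1' : 0 ≤ 1 - l := by linarith
  set φ : ℝ → ℝ := fun y => l * |y - a| + (1 - l) * |y - b| + c with hφ
  have hφ0 : ∀ y, 0 ≤ φ y := fun y => (abs_nonneg _).trans (hle y)
  set g : ℝ → ℝ := fun y => φ y - |y - k| with hg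
  have hg0 : ∀ y, 0 ≤ g y := fun y => sub_nonneg.2 (hle y)
  have hgm : Measurable fun y => ENNReal.ofReal (g y) := by
    have : Continuous g := by fun_prop
    exact this.measurable.ennreal_ofReal
  have hsum : ∀ (κ : Kernel ℝ ℝ) (z : ℝ), ∫⁻ y, ENNReal.ofReal (φ y) ∂κ z =
      ∫⁻ y, ENNReal.ofReal |y - k| ∂κ z + ∫⁻ y, ENNReal.ofReal (g y) ∂κ z := by
    intro κ z
    rw [← lintegral_add_left hm]
    congr with y
    rw [← ENNReal.ofReal_add (abs_nonneg _) (hg0 y), hg, add_sub_cancel]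
  have hsplit : ∀ κ : Kernel ℝ ℝ, ∫⁻ z in Iic x, ∫⁻ y, ENNReal.ofReal (φ y) ∂κ z ∂μ =
      ∫⁻ z in Iic x, ∫⁻ y, ENNReal.ofReal |y - k| ∂κ z ∂μ +
        ∫⁻ z in Iic x, ∫⁻ y, ENNReal.ofReal (g y) ∂κ z ∂μ := by
    intro κ
    rw [← lintegral_add_left hm.lintegral_kernel]
    simp_rw [hsum]
  have hφ₁ : ∫⁻ z in Iic x, ∫⁻ y, ENNReal.ofReal (φ y) ∂κ₁ z ∂μ =
      ∫⁻ z in Iic x, ENNReal.ofReal (φ z) ∂μ := by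
    refine setLIntegral_congr_fun_ae measurableSet_Iic ?_
    filter_upwards [hT₁.ae_lintegral_eq hκT₁ hφ0] with z ⟨hzS, hz⟩ hzx
    have hd := hT₁.down_le z hzS
    have hu := hT₁.le_up z hzS
    rw [hz, hφ, twoPointMean_affine_comb,
      twoPointMean_abs_sub_of_notMem hd hu (hT₁.notMem_Ioo_of_mem_closure hzS hzx ha),
      twoPointMean_abs_sub_of_notMem hd hu (hT₁.notMem_Ioo_of_mem_closure hzS hzx hb)]
  have hφ₂ : ∫⁻ z in Iic x, ENNReal.ofReal (φ z) ∂μ ≤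
      ∫⁻ z in Iic x, ∫⁻ y, ENNReal.ofReal (φ y) ∂κ₂ z ∂μ := by
    refine lintegral_mono_ae (ae_restrict_of_ae ?_)
    filter_upwards [hT₂.ae_lintegral_eq hκT₂ hφ0] with z ⟨hzS, hz⟩
    have hd := hT₂.down_le z hzS
    have hu := hT₂.le_up z hzS
    rw [hz, hφ, twoPointMean_affine_comb]
    exact ENNReal.ofReal_le_ofReal (add_le_add_left (add_le_add
      (mul_le_mul_of_nonneg_left (abs_sub_le_twoPointMean hd hu a) hl0)
      (mul_le_mul_of_nonneg_left (abs_sub_le_twoPointMean hd hu b) hl1')) c)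
  have hg₁ : ∫⁻ z in Iic x, ∫⁻ y, ENNReal.ofReal (g y) ∂κ₁ z ∂μ =
      ∫⁻ y, ENNReal.ofReal (g y) ∂ν := by
    rw [← hP₁.lintegral_lintegral hκ₁ hgm,
      ← lintegral_add_compl (μ := μ) _ (measurableSet_Iic (a := x))]
    -- Starts beyond `x` contribute nothing, since `g = 0` on their targets.
    refine (add_zero _).symm.trans (congrArg _ ?_)
    rw [← lintegral_zero (μ := μ.restrict (Iic x)ᶜ), eq_comm]
    refine setLIntegral_congr_fun_ae measurableSet_Iic.compl ?_
    filter_upwards [hT₁.ae_lintegral_eq hκT₁ hg0] with z ⟨hzS, hz⟩ hzx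
    have hzx' : x < z := not_le.1 hzx
    rw [hz, twoPointMean, hg]
    dsimp only
    rw [heq _ ⟨z, hzS, hzx', Or.inl rfl⟩, heq _ ⟨z, hzS, hzx', Or.inr rfl⟩]
    simp [hφ]
  have hg₂ : ∫⁻ z in Iic x, ∫⁻ y, ENNReal.ofReal (g y) ∂κ₂ z ∂μ ≤
      ∫⁻ y, ENNReal.ofReal (g y) ∂ν := by
    rw [← hP₂.lintegral_lintegral hκ₂ hgm]
    exact setLIntegral_le_lintegral _ _
  have hfin : ∫⁻ y, ENNReal.ofReal (g y) ∂ν ≠ ∞ := by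
    have habs : ∀ t : ℝ, Integrable (fun y : ℝ => |y - t|) ν := fun t =>
      (hν.sub (integrable_const t)).abs
    have hint : Integrable g ν :=
      ((((habs a).const_mul l).add ((habs b).const_mul (1 - l))).add (integrable_const c)).sub
        (habs k)
    exact hint.lintegral_lt_top.ne
  refine (ENNReal.add_le_add_iff_right hfin).1 ?_
  calc _ = ∫⁻ z in Iic x, ∫⁻ y, ENNReal.ofReal (φ y) ∂κ₁ z ∂μ := by rw [hsplit, hg₁]
    _ ≤ ∫⁻ z in Iic x, ∫⁻ y, ENNReal.ofReal (φ y) ∂κ₂ z ∂μ := hφ₁ ▸ hφ₂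
    _ ≤ _ := by rw [hsplit]; gcongr

/-- Two map pairs representing martingale plans with the same marginals agree almost everywhere. -/
theorem ae_eq_of_isMonotoneMapPair [IsProbabilityMeasure μ] [IsProbabilityMeasure ν]
    (hν : Integrable (fun y : ℝ => y) ν)
    (hP₁ : IsMartingalePlan μ ν P₁) (hP₂ : IsMartingalePlan μ ν P₂)
    (hT₁ : IsMonotoneMapPair μ P₁ S₁ Td₁ Tu₁) (hT₂ : IsMonotoneMapPair μ P₂ S₂ Td₂ Tu₂) :
    ∀ᵐ x ∂μ, Td₁ x = Td₂ x ∧ Tu₁ x = Tu₂ x := by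
  obtain ⟨κ₁, _, hκ₁, hκT₁⟩ := hT₁.disintegration
  obtain ⟨κ₂, _, hκ₂, hκT₂⟩ := hT₂.disintegration
  have hpot : ∀ k : ℝ, ∀ᵐ x ∂μ, ∫⁻ y, ENNReal.ofReal |y - k| ∂κ₁ x =
      ∫⁻ y, ENNReal.ofReal |y - k| ∂κ₂ x := by
    intro k
    have hm : Measurable fun y : ℝ => ENNReal.ofReal |y - k| := by fun_prop
    have hfin : ∫⁻ x, ∫⁻ y, ENNReal.ofReal |y - k| ∂κ₁ x ∂μ ≠ ∞ := by
      rw [hP₁.lintegral_lintegral hκ₁ hm]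
      exact ((hν.sub (integrable_const k)).abs).lintegral_lt_top.ne
    -- Equal integrals over all half-lines identify the measures with these densities, hence the
    -- densities.
    refine (withDensity_eq_iff hm.lintegral_kernel.aemeasurable
      hm.lintegral_kernel.aemeasurable hfin).1 ?_
    have := isFiniteMeasure_withDensity hfin
    refine Measure.ext_of_Iic _ _ fun x => ?_
    rw [withDensity_apply _ measurableSet_Iic, withDensity_apply _ measurableSet_Iic]
    exact le_antisymm
      (setLIntegral_abs_sub_le hν hP₁ hP₂ hT₁ hT₂ hκ₁ hκ₂ hκT₁ hκT₂ x k)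
      (setLIntegral_abs_sub_le hν hP₂ hP₁ hT₂ hT₁ hκ₂ hκ₁ hκT₂ hκT₁ x k)
  have hpot' : ∀ᵐ x ∂μ, ∀ k : ℚ, ∫⁻ y, ENNReal.ofReal |y - k| ∂κ₁ x =
      ∫⁻ y, ENNReal.ofReal |y - k| ∂κ₂ x := ae_all_iff.2 fun k => hpot k
  filter_upwards [hpot', hκT₁, hκT₂, hT₁.ae_mem, hT₂.ae_mem] with x hx h1 h2 hS1 hS2
  have hd1 := hT₁.down_le x hS1
  have hu1 := hT₁.le_up x hS1
  have hd2 := hT₂.down_le x hS2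
  have hu2 := hT₂.le_up x hS2
  refine eq_of_twoPointMean_abs_sub_eq hd1 hu1 (hT₁.down_eq_iff x hS1) hd2 hu2
    (hT₂.down_eq_iff x hS2) fun k => ?_
  have := hx k
  rw [h1, h2, lintegral_twoPoint hd1 hu1 fun y => abs_nonneg _,
    lintegral_twoPoint hd2 hu2 fun y => abs_nonneg _] at this
  exact (ENNReal.ofReal_eq_ofReal_iff
    ((abs_nonneg _).trans (abs_sub_le_twoPointMean hd1 hu1 _))
    ((abs_nonneg _).trans (abs_sub_le_twoPointMean hd2 hu2 _))).1 this

end Uniqueness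

/-! ### Hitting times and exit from the interval. -/

section HittingTime

variable {Ω : Type*} {B : ℝ≥0 → Ω → ℝ} {ω : Ω} {μ : Measure ℝ} {P : Measure (ℝ × ℝ)}
  {S : Set ℝ} {Td Tu : ℝ → ℝ}

/-- Compares infima through individual visits, so neither need be attained. -/
lemma barrierTime_le_of_forall {R R' : Set (ℝ × ℝ)}
    (h : ∀ t, (B t ω - B 0 ω, B t ω) ∈ R' → ∃ s ≤ t, (B s ω - B 0 ω, B s ω) ∈ R) :
    barrierTime B R ω ≤ barrierTime B R' ω := by
  unfold barrierTime
  by_cases hex : ∃ t, (B t ω - B 0 ω, B t ω) ∈ R'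
  · rw [hittingAfter, hittingAfter]
    obtain ⟨t, ht⟩ := hex
    obtain ⟨s, _, hs⟩ := h t ht
    rw [if_pos ⟨s, zero_le, hs⟩, if_pos ⟨t, zero_le, ht⟩, WithTop.coe_le_coe]
    refine le_csInf ⟨t, zero_le, ht⟩ fun u hu => ?_
    obtain ⟨v, hvu, hv⟩ := h u hu.2
    refine le_trans (csInf_le (OrderBot.bddBelow _) ?_) hvu
    exact ⟨zero_le, hv⟩
  · rw [(hittingAfter_eq_top_iff (s := R')).2 fun j _ hj => hex ⟨j, hj⟩]
    exact le_top

/-- On the barrier the path has left the open interval `(Td (B 0), Tu (B 0))`. -/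
lemma IsMonotoneMapPair.notMem_Ioo_of_mem_barrier (hT : IsMonotoneMapPair μ P S Td Tu)
    {x y : ℝ} (hx : x ∈ S) (h : (y - x, y) ∈ barrier S Td Tu) : y ∉ Ioo (Td x) (Tu x) := by
  simp only [barrier, mem_union, mem_iUnion, mem_prod, mem_Ici, mem_singleton_iff] at h
  -- The half-line condition `hzy` amounts to `x ≤ z`: only targets of `x` or later points can be
  -- hit.
  rcases h with ⟨z, hz, hzy, rfl⟩ | ⟨z, hz, hzy, rfl⟩
  · exact fun hI => absurd hI.2 (not_lt.2 (hT.up_monotoneOn hx hz (by linarith)))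
  · rcases (by linarith : x ≤ z).eq_or_lt with rfl | hlt
    · exact fun hI => lt_irrefl _ hI.1
    · exact hT.down_notMem x hx z hz hlt

lemma exists_le_eq_of_notMem_Ioo {f : ℝ≥0 → ℝ} (hf : Continuous f) {d u : ℝ} (hd : d ≤ f 0)
    (hu : f 0 ≤ u) {t : ℝ≥0} (ht : f t ∉ Ioo d u) : ∃ s ≤ t, f s = u ∨ f s = d := by
  rcases le_or_gt (f t) d with h | h
  · obtain ⟨s, hs, e⟩ := intermediate_value_Icc' (zero_le (a := t)) hf.continuousOn
      (mem_Icc.2 ⟨h, hd⟩)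
    exact ⟨s, hs.2, Or.inr e⟩
  · have h' : u ≤ f t := by
      by_contra! h'
      exact ht ⟨h, h'⟩
    obtain ⟨s, hs, e⟩ := intermediate_value_Icc (zero_le (a := t)) hf.continuousOn
      (mem_Icc.2 ⟨hu, h'⟩)
    exact ⟨s, hs.2, Or.inl e⟩

lemma barrierTime_le {P' : Measure (ℝ × ℝ)} {S' : Set ℝ} {Td' Tu' : ℝ → ℝ}
    (hT : IsMonotoneMapPair μ P S Td Tu) (hT' : IsMonotoneMapPair μ P' S' Td' Tu')
    (hc : Continuous fun t => B t ω) (hS : B 0 ω ∈ S) (hS' : B 0 ω ∈ S')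
    (hd : Td (B 0 ω) = Td' (B 0 ω)) (hu : Tu (B 0 ω) = Tu' (B 0 ω)) :
    barrierTime B (barrier S Td Tu) ω ≤ barrierTime B (barrier S' Td' Tu') ω := by
  refine barrierTime_le_of_forall fun t ht => ?_
  have hI := hT'.notMem_Ioo_of_mem_barrier hS' ht
  rw [← hd, ← hu] at hI
  -- The exit point is an endpoint of the common interval, hence lies on the half-line indexed by `B
  -- 0 ω` itself.
  obtain ⟨s, hst, hs⟩ := exists_le_eq_of_notMem_Ioo hc (hT.down_le _ hS) (hT.le_up _ hS) hI
  refine ⟨s, hst, ?_⟩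
  simp only [barrier, mem_union, mem_iUnion, mem_prod, mem_Ici, mem_singleton_iff]
  rcases hs with hs | hs
  · exact Or.inl ⟨B 0 ω, hS, by rw [hs], hs⟩
  · exact Or.inr ⟨B 0 ω, hS, by rw [hs], hs⟩

end HittingTime

end MartingaleTransport

theorem mainTheorem6 {Ω : Type*} [MeasurableSpace Ω] (Pr : Measure Ω) [IsProbabilityMeasure Pr]
    (μ ν : Measure ℝ) [IsProbabilityMeasure μ] [IsProbabilityMeasure ν] [NullSingletonClass μ]
    (hμ : Integrable (fun x : ℝ => x) μ) (hν : Integrable (fun y : ℝ => y) ν)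
    (P₁ P₂ : Measure (ℝ × ℝ))
    (hP₁ : IsMartingalePlan μ ν P₁) (hP₂ : IsMartingalePlan μ ν P₂)
    (hm₁ : IsLeftMonotone P₁) (hm₂ : IsLeftMonotone P₂)
    (S₁ S₂ : Set ℝ) (Td₁ Tu₁ Td₂ Tu₂ : ℝ → ℝ)
    (hT₁ : IsMonotoneMapPair μ P₁ S₁ Td₁ Tu₁) (hT₂ : IsMonotoneMapPair μ P₂ S₂ Td₂ Tu₂)
    (B : ℝ≥0 → Ω → ℝ) (hB : IsBrownianFrom μ B Pr) :
    ∀ᵐ ω ∂Pr, barrierTime B (barrier S₁ Td₁ Tu₁) ω = barrierTime B (barrier S₂ Td₂ Tu₂) ω := by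
  have hlaw := hB.hasLaw_zero
  have key : ∀ᵐ x ∂μ, (Td₁ x = Td₂ x ∧ Tu₁ x = Tu₂ x) ∧ x ∈ S₁ ∧ x ∈ S₂ := by
    filter_upwards [ae_eq_of_isMonotoneMapPair hν hP₁ hP₂ hT₁ hT₂, hT₁.ae_mem, hT₂.ae_mem]
      with x h h1 h2
    exact ⟨h, h1, h2⟩
  rw [← hlaw.map_eq] at key
  filter_upwards [ae_of_ae_map hlaw.aemeasurable key, hB.isBrownian_sub.cont]
    with ω ⟨⟨hd, hu⟩, h1, h2⟩ hc
  have hcont : Continuous fun t => B t ω := by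
    simpa [Pi.add_def] using hc.add (continuous_const (y := B 0 ω))
  exact le_antisymm (barrierTime_le hT₁ hT₂ hcont h1 h2 hd hu)
    (barrierTime_le hT₂ hT₁ hcont h2 h1 hd.symm hu.symm)
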